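/- Let $\mathcal T=(\mathcal V,\mathcal E)$ be a finite tree with $d=|\mathcal V|\ge 1$ vertices, let $q\in(0,1)$ and let $\boldsymbol\alpha=(\alpha_e)_{e\in\mathcal E}\in(0,1)^{d-1}$. Let $\boldsymbol J=(J_v)_{v\in\mathcal V}$ be an Ising model on $\mathcal T$ with mean parameters $q\,\boldsymbol 1_d$ and $\boldsymbol\alpha$: a random vector with values in $\{0,1\}^{\mathcal V}$ whose joint probability mass function has the form $$p_{\boldsymbol J}(\boldsymbol x)=\exp\Big(\sum_{v\in\mathcal V}\eta_v x_v+\sum_{\{u,v\}\in\mathcal E}\eta_{\{u,v\}}x_ux_v-A\Big),\qquad \boldsymbol x\in\{0,1\}^{\mathcal V},$$ for some real numbers $\eta_v$, $\eta_{\{u,v\}}\neq 0$ and $A$, and such that $\mathbb E[J_v]=q$ for every $v\in\mathcal V$ and the Pearson correlation of $J_u$ and $J_v$ equals $\alpha_{\{u,v\}}$ for every $\{u,v\}\in\mathcal E$. Let $\boldsymbol N=(N_v)_{v\in\mathcal V}\sim\mathrm{MPMRF}(q,\boldsymbol\alpha,\mathcal T)$, that is, for some root $r\in\mathcal V$, $\boldsymbol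 N$ has the distribution of the random vector defined recursively along the tree rooted at $r$ by $$N_r=L_r,\qquad N_v=\sum_{i=1}^{N_{\mathrm{pa}(v)}}I_{v,i}+L_v\quad(v\neq r),$$ where $\mathrm{pa}(v)$ is the parent of $v$, all the variables $L_v$ $(v\in\mathcal V)$ and $I_{v,i}$ $(v\ne r,\ i\ge1)$ are mutually independent, $L_r$ is Poisson with mean $q$, $L_v$ is Poisson with mean $q(1-\alpha_{\{\mathrm{pa}(v),v\}})$ and $I_{v,i}$ is Bernoulli with success probability $\alpha_{\{\mathrm{pa}(v),v\}}$. Then, whatever the value of $\boldsymbol\alpha$, $$d_{\mathrm{TV}}(\boldsymbol J,\boldsymbol N)=\sup_{A\in\mathcal B(\mathbb R^{\mathcal V})}\big|\Pr(\boldsymbol J\in A)-\Pr(\boldsymbol N\in A)\big|\le 1.2\,d\,q^2 .$$ -/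

import Mathlib

open MeasureTheory ProbabilityTheory

/-- Total variation distance between (the laws of) two random elements `X` and `Y` of `E`, possibly
defined on different probability spaces: the supremum of `|Pr(X ∈ A) - Pr(Y ∈ A)|` over all
measurable sets `A`. -/
noncomputable def tvDist {Ω Ω' E : Type*} [MeasurableSpace Ω] [MeasurableSpace Ω']
    [MeasurableSpace E] (P : Measure Ω) (X : Ω → E) (P' : Measure Ω') (Y : Ω' → E) : ℝ :=
  ⨆ A : {A : Set E // MeasurableSet A}, |P.real (X ⁻¹' A.1) - P'.real (Y ⁻¹' A.1)|

/-- Pearson's correlation coefficient. -/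
noncomputable def pearsonCorr {Ω : Type*} [MeasurableSpace Ω] (P : Measure Ω) (X Y : Ω → ℝ) : ℝ :=
  covariance X Y P / Real.sqrt (variance X P * variance Y P)

/-- The random vector `J` follows an Ising model on the graph `G`: it takes values in `{0,1}^V`, and
its joint probability mass function is
`x ↦ exp (∑ v, η_v x_v + ∑ {u,v} ∈ E, η_{u,v} x_u x_v - A)`, where the second order natural
parameters `η_{u,v}` of the edges are non-zero. -/
structure IsIsingModel {Ω V : Type*} [MeasurableSpace Ω] [Fintype V]
    (G : SimpleGraph V) (P : Measure Ω) (J : Ω → V → ℕ) : Prop where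
  measurable : Measurable J
  binary : ∀ᵐ ω ∂P, ∀ v, J ω v = 0 ∨ J ω v = 1
  pmf : open Classical in
    ∃ (η₁ : V → ℝ) (η₂ : Sym2 V → ℝ) (A : ℝ),
      (∀ e ∈ G.edgeSet, η₂ e ≠ 0) ∧
      ∀ x : V → ℕ, (∀ v, x v = 0 ∨ x v = 1) →
        P.real (J ⁻¹' {x}) =
          Real.exp (∑ v, η₁ v * (x v : ℝ)
            + ∑ e ∈ G.edgeFinset, η₂ e * ((Sym2.mul (e.map x) : ℕ) : ℝ) - A)

/-- The Ising model `J` on `G` has mean parameters `q` (the marginal means) and `α` (the Pearson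
correlations of the pairs of components joined by an edge). Values of `α` off the edge set of `G`
play no role. -/
structure IsMeanParamIsing {Ω V : Type*} [MeasurableSpace Ω] [Fintype V]
    (G : SimpleGraph V) (q : V → ℝ) (α : Sym2 V → ℝ) (P : Measure Ω) (J : Ω → V → ℕ) : Prop where
  ising : IsIsingModel G P J
  mean : ∀ v, ∫ ω, (J ω v : ℝ) ∂P = q v
  corr : ∀ u v, G.Adj u v →
    pearsonCorr P (fun ω => (J ω u : ℝ)) (fun ω => (J ω v : ℝ)) = α s(u, v)

/-- In a tree `T` rooted at `r`, the vertex `u` is the parent of `v`: the neighbour of `v` that is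
one step closer to the root. -/
def IsParent {V : Type*} (T : SimpleGraph V) (r u v : V) : Prop :=
  T.Adj u v ∧ T.dist r v = T.dist r u + 1

/-- The Bernoulli distribution of success probability `p`, as a measure on `ℕ`. -/
noncomputable def bernoulliLaw (p : ℝ) : Measure ℕ :=
  ENNReal.ofReal p • Measure.dirac 1 + ENNReal.ofReal (1 - p) • Measure.dirac 0

/-- The stochastic representation, with root `r`, of the tree-structured Markov random field with
Poisson marginals of mean `lam`: `N r = L r`, and
`N v = α ∘ N (pa v) + L v` for `v ≠ r`, where `α = α_{(pa v, v)}` and where the binomial thinning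
`α ∘ N (pa v)` is the sum of the first `N (pa v)` terms of the sequence `I v` of Bernoulli trials.
All innovations `L v` and all trials `I v i` are mutually independent. (`I r` is never used.) -/
structure IsMPMRFRepresentation {Ω V : Type*} [MeasurableSpace Ω]
    (lam : ℝ) (α : Sym2 V → ℝ) (T : SimpleGraph V) (r : V) (P : Measure Ω)
    (L : V → Ω → ℕ) (I : V → ℕ → Ω → ℕ) (N : Ω → V → ℕ) : Prop where
  indep : iIndepFun (Sum.elim L fun p : V × ℕ => I p.1 p.2) P
  law_root : HasLaw (L r) (poissonMeasure lam.toNNReal) P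
  law_innovation : ∀ u v, IsParent T r u v →
    HasLaw (L v) (poissonMeasure (lam * (1 - α s(u, v))).toNNReal) P
  law_trial : ∀ u v, IsParent T r u v → ∀ i, HasLaw (I v i) (bernoulliLaw (α s(u, v))) P
  eq_root : ∀ ω, N ω r = L r ω
  eq_child : ∀ u v, IsParent T r u v → ∀ ω,
    N ω v = ∑ i ∈ Finset.range (N ω u), I v i ω + L v ω

/-- `N ∼ MPMRF(lam, α, T)`: the random vector `N` has the distribution of a random vector `N'`
given, for some choice of a root, by the stochastic representation above. -/
def IsMPMRF {Ω V : Type*} [MeasurableSpace Ω]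
    (lam : ℝ) (α : Sym2 V → ℝ) (T : SimpleGraph V) (P : Measure Ω) (N : Ω → V → ℕ) : Prop :=
  ∃ (r : V) (Ω' : Type) (_ : MeasurableSpace Ω') (P' : Measure Ω') (_ : IsProbabilityMeasure P')
    (L : V → Ω' → ℕ) (I : V → ℕ → Ω' → ℕ) (N' : Ω' → V → ℕ),
    IsMPMRFRepresentation lam α T r P' L I N' ∧ IdentDistrib N N' P P'

/-! Rooting the tree factorises both laws over parent-child pairs. The Ising law is the Bernoulli
product mass weighted by one factor `1 + β_v c(x_{pa v}) c(x_v)` per edge, with `β_v = α/(q(1-q))`: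
building the tree up leaf by leaf shows that this mass has the prescribed means and covariances
(`interactionMass_moments`), and within a pairwise exponential family these moments determine the
law, because the symmetrised Kullback-Leibler divergence of two members sharing them vanishes
(`eq_interactionMass`). On the other side, the mass of `N` at a bit vector is at least the product
of its transition probabilities, since a parent with value at most 1 uses at most one thinning trial
(`IsMPMRFRepresentation.prod_le_measureReal`).

As `J` is binary, the distance is controlled by the excess of the Ising mass over that product. For
products, `∏ a - ∏ b ≤ ∏ a * ∑ max 0 (1 - b/a)` (`prod_sub_prod_le`), so the excess is at most a sum
over vertices of Ising expectations. Each involves only one or two bits, hence is explicit, and `1 -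
t ≤ exp (-t)` bounds it by `q ^ 2`. The total is `d * q ^ 2`, which is better than required. -/

/-! ### Tree-structured binary mass functions and their moments. -/

/-- The mass function of the Bernoulli distribution with mean `q`. -/
def bernoulliMass (q : ℝ) (b : Bool) : ℝ := cond b q (1 - q)

/-- The centred value `b - q` of a bit `b`. -/
def centeredBit (q : ℝ) (b : Bool) : ℝ := cond b (1 - q) (-q)

/-- The joint mass function on `{0,1}^V` obtained by perturbing the independent Bernoulli mass
function by the pair interactions `1 + β_v c(x_{pa v}) c(x_v)`, `v ∈ S`. -/
def interactionMass {V : Type*} [Fintype V] (q : ℝ) (β : V → ℝ) (pa : V → V) (S : Finset V)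
    (x : V → Bool) : ℝ :=
  (∏ w, bernoulliMass q (x w)) *
    ∏ v ∈ S, (1 + β v * centeredBit q (x (pa v)) * centeredBit q (x v))

lemma bernoulliMass_pos {q : ℝ} (hq : q ∈ Set.Ioo (0 : ℝ) 1) (b : Bool) :
    0 < bernoulliMass q b := by
  have := hq.1
  have := hq.2
  cases b <;> simp [bernoulliMass] <;> linarith

lemma centeredBit_sq (q : ℝ) (b : Bool) :
    centeredBit q b * centeredBit q b = q * (1 - q) + (1 - 2 * q) * centeredBit q b := by
  cases b <;> simp [centeredBit] <;> ring

/-- Flipping bit `v` pairs up configurations on which `F` agrees, so `k` may be replaced by its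
average. -/
lemma sum_mul_apply_of_update_eq {V : Type*} [Fintype V] [DecidableEq V] (v : V)
    (F : (V → Bool) → ℝ) (hF : ∀ x b, F (Function.update x v b) = F x) (k : Bool → ℝ) :
    ∑ x, F x * k (x v) = (k true + k false) / 2 * ∑ x, F x := by
  have hinv : Function.Involutive fun x : V → Bool => Function.update x v (!x v) := by
    intro x
    simp
  have h1 := Equiv.sum_comp hinv.toPerm fun x => F x * k (x v)
  have h2 : ∑ x, F x * k (x v) + ∑ x, F x * k (!x v) = (k true + k false) * ∑ x, F x := by
    rw [← Finset.sum_add_distrib, Finset.mul_sum]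
    refine Finset.sum_congr rfl fun x _ => ?_
    cases x v <;> simp <;> ring
  simp only [Function.Involutive.coe_toPerm, hF, Function.update_self] at h1
  linarith

/-- Independence under the product law: the bit at `v` integrates out of anything that does not
depend on it. -/
lemma sum_bernoulli_mul_apply {V : Type*} [Fintype V] [DecidableEq V] (q : ℝ) (v : V)
    (F : (V → Bool) → ℝ) (hF : ∀ x b, F (Function.update x v b) = F x) (k : Bool → ℝ) :
    ∑ x, (∏ w, bernoulliMass q (x w)) * F x * k (x v) =
      (q * k true + (1 - q) * k false) * ∑ x, (∏ w, bernoulliMass q (x w)) * F x := by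
  set G : (V → Bool) → ℝ := fun x => (∏ w ∈ Finset.univ.erase v, bernoulliMass q (x w)) * F x
  have hG : ∀ x b, G (Function.update x v b) = G x := by
    intro x b
    simp only [G, hF]
    congr 1
    refine Finset.prod_congr rfl fun w hw => ?_
    rw [Function.update_of_ne (Finset.ne_of_mem_erase hw)]
  have hsplit : ∀ x : V → Bool, (∏ w, bernoulliMass q (x w)) * F x =
      G x * bernoulliMass q (x v) := by
    intro x
    simp only [G]
    rw [← Finset.mul_prod_erase Finset.univ (fun w => bernoulliMass q (x w)) (Finset.mem_univ v)]
    ring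
  simp only [hsplit, mul_assoc]
  rw [sum_mul_apply_of_update_eq v G hG (fun b => bernoulliMass q b * k b),
    sum_mul_apply_of_update_eq v G hG]
  simp [bernoulliMass]
  ring

/-- The mass function `interactionMass` is normalised, has marginal means `q`, and the covariance of
`v` and `pa v` is `β_v (q(1-q))²`, provided that `pa` decreases some height function on `S`. -/
lemma interactionMass_moments {V : Type*} [Fintype V] [DecidableEq V] (q : ℝ) (β : V → ℝ)
    (pa : V → V) (h : V → ℕ) (S : Finset V) (hS : ∀ v ∈ S, h (pa v) < h v) :
    ∑ x, interactionMass q β pa S x = 1 ∧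
    (∀ w, ∑ x, interactionMass q β pa S x * centeredBit q (x w) = 0) ∧
    ∀ v ∈ S, ∑ x, interactionMass q β pa S x * (centeredBit q (x (pa v)) * centeredBit q (x v)) =
      β v * (q * (1 - q)) ^ 2 := by
  -- Inserting vertices by increasing height makes the new vertex `a` a leaf: no earlier factor
  -- involves its bit, which is therefore still an independent Bernoulli variable under the old
  -- mass.
  induction S using Finset.induction_on_max_value h with
  | empty =>
    have hone : ∑ x : V → Bool, ∏ w, bernoulliMass q (x w) = 1 := by
      have := Finset.prod_univ_sum (fun _ : V => (Finset.univ : Finset Bool))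
        (fun _ b => bernoulliMass q b)
      rw [Fintype.piFinset_univ] at this
      rw [← this]
      simp [bernoulliMass]
    refine ⟨by simpa [interactionMass] using hone, fun w => ?_, by simp⟩
    have := sum_bernoulli_mul_apply q w (fun _ => 1) (fun _ _ => rfl) (centeredBit q)
    simp only [interactionMass, Finset.prod_empty]
    rw [this]
    simp [centeredBit]
    left
    ring
  | insert a S ha hmax ih =>
    obtain ⟨i0, i1, i2⟩ := ih fun v hv => hS v (Finset.mem_insert_of_mem hv)
    have hpa : pa a ≠ a := fun e => by
      have := hS a (Finset.mem_insert_self a S)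
      rw [e] at this
      exact lt_irrefl _ this
    have hfree : ∀ v ∈ S, pa v ≠ a ∧ v ≠ a := by
      intro v hv
      refine ⟨fun e => ?_, fun e => ha (e ▸ hv)⟩
      have h1 := hS v (Finset.mem_insert_of_mem hv)
      have h2 := hmax v hv
      rw [e] at h1
      omega
    set W := interactionMass q β pa S with hW
    have hstep : ∀ x, interactionMass q β pa (insert a S) x =
        W x + β a * (W x * centeredBit q (x (pa a)) * centeredBit q (x a)) := by
      intro x
      simp only [hW, interactionMass, Finset.prod_insert ha]
      ring
    have key : ∀ F : (V → Bool) → ℝ, (∀ x b, F (Function.update x a b) = F x) →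
        ∀ k : Bool → ℝ, ∑ x, W x * F x * k (x a) =
          (q * k true + (1 - q) * k false) * ∑ x, W x * F x := by
      intro F hF k
      have := sum_bernoulli_mul_apply q a (fun x =>
        (∏ v ∈ S, (1 + β v * centeredBit q (x (pa v)) * centeredBit q (x v))) * F x) ?_ k
      · simpa only [hW, interactionMass, mul_assoc] using this
      · intro x b
        simp only [hF]
        congr 1
        refine Finset.prod_congr rfl fun v hv => ?_
        rw [Function.update_of_ne (hfree v hv).1, Function.update_of_ne (hfree v hv).2]
    have key0 : ∀ F : (V → Bool) → ℝ, (∀ x b, F (Function.update x a b) = F x) →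
        ∑ x, W x * F x * centeredBit q (x a) = 0 := by
      intro F hF
      rw [key F hF]
      simp [centeredBit]
      left
      ring
    have key1 : ∀ F : (V → Bool) → ℝ, (∀ x b, F (Function.update x a b) = F x) →
        ∑ x, W x * F x * (centeredBit q (x a) * centeredBit q (x a)) =
          q * (1 - q) * ∑ x, W x * F x := by
      intro F hF
      rw [key F hF (fun b => centeredBit q b * centeredBit q b)]
      simp [centeredBit]
      left
      ring
    refine ⟨?_, fun w => ?_, fun v hv => ?_⟩
    · simp only [hstep, Finset.sum_add_distrib, ← Finset.mul_sum, i0]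
      rw [key0 (fun x => centeredBit q (x (pa a)))
        (fun x b => by rw [Function.update_of_ne hpa])]
      simp
    · rcases eq_or_ne w a with rfl | hw
      · have e : ∀ x, interactionMass q β pa (insert w S) x * centeredBit q (x w) =
            W x * centeredBit q (x w) + β w *
              (W x * centeredBit q (x (pa w)) * (centeredBit q (x w) * centeredBit q (x w))) := by
          intro x
          rw [hstep]
          ring
        simp only [e, Finset.sum_add_distrib, ← Finset.mul_sum, i1]
        rw [key1 (fun x => centeredBit q (x (pa w)))
          (fun x b => by rw [Function.update_of_ne hpa]), i1]
        simp
      · have e : ∀ x, interactionMass q β pa (insert a S) x * centeredBit q (x w) =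
            W x * centeredBit q (x w) + β a *
              (W x * (centeredBit q (x (pa a)) * centeredBit q (x w)) * centeredBit q (x a)) := by
          intro x
          rw [hstep]
          ring
        simp only [e, Finset.sum_add_distrib, ← Finset.mul_sum, i1]
        rw [key0 (fun x => centeredBit q (x (pa a)) * centeredBit q (x w))
          (fun x b => by rw [Function.update_of_ne hpa, Function.update_of_ne hw])]
        simp
    · rcases Finset.mem_insert.1 hv with rfl | hv
      · have e : ∀ x, interactionMass q β pa (insert v S) x *
              (centeredBit q (x (pa v)) * centeredBit q (x v)) =
            W x * centeredBit q (x (pa v)) * centeredBit q (x v) + β v *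
              (W x * (centeredBit q (x (pa v)) * centeredBit q (x (pa v))) *
                (centeredBit q (x v) * centeredBit q (x v))) := by
          intro x
          rw [hstep]
          ring
        have e' : ∀ x, W x * (centeredBit q (x (pa v)) * centeredBit q (x (pa v))) =
            q * (1 - q) * W x + (1 - 2 * q) * (W x * centeredBit q (x (pa v))) := by
          intro x
          rw [centeredBit_sq]
          ring
        simp only [e, Finset.sum_add_distrib, ← Finset.mul_sum]
        rw [key0 (fun x => centeredBit q (x (pa v)))
            (fun x b => by rw [Function.update_of_ne hpa]),
          key1 (fun x => centeredBit q (x (pa v)) * centeredBit q (x (pa v)))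
            (fun x b => by rw [Function.update_of_ne hpa])]
        simp only [e', Finset.sum_add_distrib, ← Finset.mul_sum, i0, i1]
        ring
      · have e : ∀ x, interactionMass q β pa (insert a S) x *
              (centeredBit q (x (pa v)) * centeredBit q (x v)) =
            W x * (centeredBit q (x (pa v)) * centeredBit q (x v)) + β a *
              (W x * (centeredBit q (x (pa a)) *
                (centeredBit q (x (pa v)) * centeredBit q (x v))) * centeredBit q (x a)) := by
          intro x
          rw [hstep]
          ring
        simp only [e, Finset.sum_add_distrib, ← Finset.mul_sum, i2 v hv]
        rw [key0 (fun x => centeredBit q (x (pa a)) *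
            (centeredBit q (x (pa v)) * centeredBit q (x v)))
          (fun x b => by rw [Function.update_of_ne hpa, Function.update_of_ne (hfree v hv).1,
            Function.update_of_ne (hfree v hv).2])]
        simp

/-! ### Moments determine the law. -/

/-- Expectations of functions of one bit are determined by the mean. -/
lemma sum_mul_apply_of_mean {V : Type*} [Fintype V] [DecidableEq V] {q : ℝ} {p : (V → Bool) → ℝ}
    (h0 : ∑ x, p x = 1) {v : V} (hv : ∑ x, p x * centeredBit q (x v) = 0) (f : Bool → ℝ) :
    ∑ x, p x * f (x v) = q * f true + (1 - q) * f false := by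
  have e : ∀ x, p x * f (x v) = (q * f true + (1 - q) * f false) * p x +
      (f true - f false) * (p x * centeredBit q (x v)) := by
    intro x
    cases x v <;> simp [centeredBit] <;> ring
  simp only [e, Finset.sum_add_distrib, ← Finset.mul_sum, h0, hv]
  ring

/-- Expectations of functions of two bits are determined by the means and the covariance. -/
lemma sum_mul_pair_of_moments {V : Type*} [Fintype V] [DecidableEq V] {q κ : ℝ} {p : (V → Bool) → ℝ}
    (h0 : ∑ x, p x = 1) {u v : V} (hu : ∑ x, p x * centeredBit q (x u) = 0)
    (hv : ∑ x, p x * centeredBit q (x v) = 0)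
    (huv : ∑ x, p x * (centeredBit q (x u) * centeredBit q (x v)) = κ) (g : Bool → Bool → ℝ) :
    ∑ x, p x * g (x u) (x v) = (q ^ 2 + κ) * g true true + (q * (1 - q) - κ) * g true false +
      (q * (1 - q) - κ) * g false true + ((1 - q) ^ 2 + κ) * g false false := by
  -- Expansion of `g` in the basis `1`, `c(x_u)`, `c(x_v)`, `c(x_u) c(x_v)` of functions of two
  -- bits.
  have e : ∀ x, p x * g (x u) (x v) =
      (q ^ 2 * g true true + q * (1 - q) * g true false + q * (1 - q) * g false true +
        (1 - q) ^ 2 * g false false) * p x +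
      (q * g true true + (1 - q) * g true false - q * g false true - (1 - q) * g false false) *
        (p x * centeredBit q (x u)) +
      (q * g true true - q * g true false + (1 - q) * g false true - (1 - q) * g false false) *
        (p x * centeredBit q (x v)) +
      (g true true - g true false - g false true + g false false) *
        (p x * (centeredBit q (x u) * centeredBit q (x v))) := by
    intro x
    cases x u <;> cases x v <;> simp [centeredBit] <;> ring
  simp only [e, Finset.sum_add_distrib, ← Finset.mul_sum, h0, hu, hv, huv]
  ring

/-- Two positive mass functions on a finite set whose log-ratio has the same expectation under both
coincide. -/
lemma eq_of_sum_sub_mul_log_sub_eq_zero {ι : Type*} [Fintype ι] {p w : ι → ℝ}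
    (hp : ∀ x, 0 < p x) (hw : ∀ x, 0 < w x)
    (h : ∑ x, (p x - w x) * (Real.log (p x) - Real.log (w x)) = 0) : p = w := by
  -- Since `log` is increasing, both differences have the same sign.
  have hnn : ∀ x, 0 ≤ (p x - w x) * (Real.log (p x) - Real.log (w x)) := by
    intro x
    rcases le_total (p x) (w x) with hl | hl
    · exact mul_nonneg_of_nonpos_of_nonpos (by linarith)
        (by linarith [Real.log_le_log (hp x) hl])
    · exact mul_nonneg (by linarith) (by linarith [Real.log_le_log (hw x) hl])
  funext x
  have hx := (Finset.sum_eq_zero_iff_of_nonneg fun x _ => hnn x).1 h x (Finset.mem_univ x)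
  rcases mul_eq_zero.1 hx with hx | hx
  · linarith
  · exact Real.log_injOn_pos (hp x) (hw x) (by linarith)

/-- In a pairwise exponential family indexed by the pairs `(pa v, v)`, `v ∈ S`, the mass function
with given moments is `interactionMass`. -/
lemma eq_interactionMass {V : Type*} [Fintype V] [DecidableEq V] {q : ℝ}
    (hq : q ∈ Set.Ioo (0 : ℝ) 1) {β : V → ℝ} {pa : V → V} {h : V → ℕ} {S : Finset V}
    (hS : ∀ v ∈ S, h (pa v) < h v)
    (hβ : ∀ v ∈ S, ∀ y z, 0 < 1 + β v * centeredBit q y * centeredBit q z)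
    {p : (V → Bool) → ℝ} (a : ℝ) (f : V → Bool → ℝ) (g : V → Bool → Bool → ℝ)
    (hp : ∀ x, p x = Real.exp (a + ∑ v, f v (x v) + ∑ v ∈ S, g v (x (pa v)) (x v)))
    (h0 : ∑ x, p x = 1) (h1 : ∀ w, ∑ x, p x * centeredBit q (x w) = 0)
    (h2 : ∀ v ∈ S, ∑ x, p x * (centeredBit q (x (pa v)) * centeredBit q (x v)) =
      β v * (q * (1 - q)) ^ 2) :
    p = interactionMass q β pa S := by
  obtain ⟨w0, w1, w2⟩ := interactionMass_moments q β pa h S hS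
  set W := interactionMass q β pa S with hWdef
  have hm : ∀ b, 0 < bernoulliMass q b := bernoulliMass_pos hq
  have hW : ∀ x, 0 < W x := fun x =>
    mul_pos (Finset.prod_pos fun w _ => hm _) (Finset.prod_pos fun v hv => hβ v hv _ _)
  refine eq_of_sum_sub_mul_log_sub_eq_zero (fun x => by rw [hp]; exact Real.exp_pos _) hW ?_
  -- The log-ratio splits into functions of one vertex or one edge, whose expectations under `p` and
  -- `W` agree by the shared moments.
  have hlog : ∀ x, Real.log (p x) - Real.log (W x) = a +
      ∑ v, (f v (x v) - Real.log (bernoulliMass q (x v))) +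
      ∑ v ∈ S, (g v (x (pa v)) (x v) -
        Real.log (1 + β v * centeredBit q (x (pa v)) * centeredBit q (x v))) := by
    intro x
    rw [hp, Real.log_exp, hWdef, interactionMass, Real.log_mul
      (Finset.prod_pos fun w _ => hm _).ne' (Finset.prod_pos fun v hv => hβ v hv _ _).ne',
      Real.log_prod (fun w _ => (hm _).ne'), Real.log_prod (fun v hv => (hβ v hv _ _).ne')]
    simp only [Finset.sum_sub_distrib]
    ring
  have hE1 : ∀ v, ∑ x, (p x - W x) * (f v (x v) - Real.log (bernoulliMass q (x v))) = 0 := by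
    intro v
    simp only [sub_mul (p _) (W _), Finset.sum_sub_distrib (f := fun x => p x * _)]
    rw [sum_mul_apply_of_mean h0 (h1 v) (fun b => f v b - Real.log (bernoulliMass q b)),
      sum_mul_apply_of_mean w0 (w1 v) (fun b => f v b - Real.log (bernoulliMass q b)), sub_self]
  have hE2 : ∀ v ∈ S, ∑ x, (p x - W x) * (g v (x (pa v)) (x v) -
      Real.log (1 + β v * centeredBit q (x (pa v)) * centeredBit q (x v))) = 0 := by
    intro v hv
    simp only [sub_mul (p _) (W _), Finset.sum_sub_distrib (f := fun x => p x * _)]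
    rw [sum_mul_pair_of_moments h0 (h1 (pa v)) (h1 v) (h2 v hv)
        (fun y z => g v y z - Real.log (1 + β v * centeredBit q y * centeredBit q z)),
      sum_mul_pair_of_moments w0 (w1 (pa v)) (w1 v) (w2 v hv)
        (fun y z => g v y z - Real.log (1 + β v * centeredBit q y * centeredBit q z)), sub_self]
  simp only [hlog, mul_add, Finset.sum_add_distrib, Finset.mul_sum]
  rw [Finset.sum_comm, Finset.sum_comm (t := S), Finset.sum_eq_zero fun v _ => hE1 v,
    Finset.sum_eq_zero hE2, ← Finset.sum_mul, Finset.sum_sub_distrib, h0, w0]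
  simp

/-! ### Comparison of products. -/

lemma one_sub_sum_le_prod_one_sub {ι : Type*} (s : Finset ι) (c : ι → ℝ)
    (h0 : ∀ i ∈ s, 0 ≤ c i) (h1 : ∀ i ∈ s, c i ≤ 1) :
    1 - ∑ i ∈ s, c i ≤ ∏ i ∈ s, (1 - c i) := by
  classical
  induction s using Finset.induction_on with
  | empty => simp
  | insert a s ha ih =>
    rw [Finset.sum_insert ha, Finset.prod_insert ha]
    have hs := ih (fun i hi => h0 i (Finset.mem_insert_of_mem hi))
      fun i hi => h1 i (Finset.mem_insert_of_mem hi)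
    have ha0 := h0 a (Finset.mem_insert_self a s)
    have ha1 := h1 a (Finset.mem_insert_self a s)
    have hsum : 0 ≤ ∑ i ∈ s, c i :=
      Finset.sum_nonneg fun i hi => h0 i (Finset.mem_insert_of_mem hi)
    nlinarith [mul_le_mul_of_nonneg_left hs (sub_nonneg.2 ha1), mul_nonneg ha0 hsum]

/-- Telescoping comparison of two products of nonnegative numbers. -/
lemma prod_sub_prod_le {ι : Type*} (s : Finset ι) (a b : ι → ℝ) (ha : ∀ i ∈ s, 0 < a i)
    (hb : ∀ i ∈ s, 0 ≤ b i) :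
    ∏ i ∈ s, a i - ∏ i ∈ s, b i ≤ (∏ i ∈ s, a i) * ∑ i ∈ s, max 0 (1 - b i / a i) := by
  have h1 := one_sub_sum_le_prod_one_sub s (fun i => max 0 (1 - b i / a i))
    (fun i _ => le_max_left _ _) fun i hi => max_le zero_le_one
      (by linarith [div_nonneg (hb i hi) (ha i hi).le])
  -- Each factor on the left is `min (a i) (b i)`.
  have h2 : (∏ i ∈ s, a i) * ∏ i ∈ s, (1 - max 0 (1 - b i / a i)) ≤ ∏ i ∈ s, b i := by
    rw [← Finset.prod_mul_distrib]
    refine Finset.prod_le_prod (fun i hi => mul_nonneg (ha i hi).le ?_) fun i hi => ?_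
    · linarith [max_le zero_le_one
        (by linarith [div_nonneg (hb i hi) (ha i hi).le] : 1 - b i / a i ≤ 1)]
    · calc a i * (1 - max 0 (1 - b i / a i)) ≤ a i * (b i / a i) := by
            refine mul_le_mul_of_nonneg_left ?_ (ha i hi).le
            linarith [le_max_right 0 (1 - b i / a i)]
        _ = b i := mul_div_cancel₀ _ (ha i hi).ne'
  nlinarith [mul_le_mul_of_nonneg_left h1 (Finset.prod_pos ha).le]

/-! ### Rooted trees. -/

/-- The first step of a shortest walk from `v` to the root leads to a parent. -/
lemma exists_isParent {V : Type*} {T : SimpleGraph V} (hT : T.Connected) {r v : V} (hv : v ≠ r) :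
    ∃ u, IsParent T r u v := by
  obtain ⟨p, hp⟩ := hT.exists_walk_length_eq_dist v r
  cases p with
  | nil => exact absurd rfl hv
  | @cons _ u _ hadj p =>
    refine ⟨u, hadj.symm, ?_⟩
    have h1 := SimpleGraph.dist_le p
    have h2 := hT.dist_triangle (u := r) (v := u) (w := v)
    rw [SimpleGraph.dist_eq_one_iff_adj.2 hadj.symm] at h2
    rw [SimpleGraph.Walk.length_cons, SimpleGraph.dist_comm] at hp
    rw [SimpleGraph.dist_comm] at h1
    omega

/-- The edges of a rooted tree are the pairs of a non-root vertex and its parent. -/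
lemma sum_edgeFinset_eq_sum_parent {V : Type*} [Fintype V] [DecidableEq V] {T : SimpleGraph V}
    {_ : Fintype T.edgeSet} (hT : T.IsTree) {r : V} {pa : V → V}
    (hpa : ∀ v, v ≠ r → IsParent T r (pa v) v) (F : Sym2 V → ℝ) :
    ∑ e ∈ T.edgeFinset, F e = ∑ v ∈ Finset.univ.erase r, F s(pa v, v) := by
  have hinj : Set.InjOn (fun v => s(pa v, v)) (Finset.univ.erase r : Finset V) := by
    intro v hv w hw he
    have hv' := (hpa v (by simpa using hv)).2
    have hw' := (hpa w (by simpa using hw)).2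
    rcases Sym2.eq_iff.1 he with ⟨-, h⟩ | ⟨h1, h2⟩
    · exact h
    · rw [h1] at hv'
      rw [← h2] at hw'
      omega
  -- Inclusion suffices, as a tree has exactly one edge fewer than vertices.
  have himg : (Finset.univ.erase r).image (fun v => s(pa v, v)) = T.edgeFinset := by
    refine Finset.eq_of_subset_of_card_le ?_ ?_
    · intro e he
      obtain ⟨v, hv, rfl⟩ := Finset.mem_image.1 he
      exact SimpleGraph.mem_edgeFinset.2 (hpa v (by simpa using hv)).1
    · rw [Finset.card_image_of_injOn hinj, Finset.card_erase_of_mem (Finset.mem_univ r),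
        Finset.card_univ, ← hT.card_edgeFinset]
      simp
  rw [← himg, Finset.sum_image hinj]

/-! ### The law of the Ising model. -/

/-- A vector of bits as a vector of natural numbers. -/
def bitVector {V : Type*} (x : V → Bool) : V → ℕ := fun v => (x v).toNat

lemma bitVector_injective {V : Type*} : Function.Injective (bitVector (V := V)) := by
  intro x y h
  funext v
  have := congrFun h v
  cases hx : x v <;> cases hy : y v <;> simp [bitVector, hx, hy] at this ⊢

/-- The expectation of a function of a random binary vector is a finite sum. -/
lemma integral_comp_of_binary {Ω V : Type*} [MeasurableSpace Ω] [Fintype V] [DecidableEq V]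
    {P : Measure Ω} [IsProbabilityMeasure P] {J : Ω → V → ℕ} (hJ : Measurable J)
    (hb : ∀ᵐ ω ∂P, ∀ v, J ω v = 0 ∨ J ω v = 1) (f : (V → ℕ) → ℝ) :
    ∫ ω, f (J ω) ∂P = ∑ x : V → Bool, P.real (J ⁻¹' {bitVector x}) * f (bitVector x) := by
  have hm : ∀ x : V → Bool, MeasurableSet (J ⁻¹' {bitVector x}) := fun x =>
    hJ (measurableSet_singleton _)
  have hae : (fun ω => f (J ω)) =ᵐ[P] fun ω =>
      ∑ x : V → Bool, (J ⁻¹' {bitVector x}).indicator (fun _ => f (bitVector x)) ω := by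
    filter_upwards [hb] with ω hω
    have hx : J ω = bitVector fun v => decide (J ω v = 1) := by
      funext v
      rcases hω v with h | h <;> simp [bitVector, h]
    rw [Finset.sum_eq_single (fun v => decide (J ω v = 1))]
    · rw [Set.indicator_of_mem (by exact hx), ← hx]
    · intro y _ hy
      refine Set.indicator_of_notMem (fun h => hy (bitVector_injective ?_)) _
      rw [← hx]
      exact h.symm
    · simp
  rw [integral_congr_ae hae, integral_finsetSum _ fun x _ =>
    (integrable_const (f (bitVector x))).indicator (hm x)]
  refine Finset.sum_congr rfl fun x _ => ?_
  rw [integral_indicator_const _ (hm x), smul_eq_mul]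

lemma one_add_mul_centeredBit_pos {q a : ℝ} (hq : q ∈ Set.Ioo (0 : ℝ) 1)
    (ha : a ∈ Set.Ioo (0 : ℝ) 1) (y z : Bool) :
    0 < 1 + a / (q * (1 - q)) * centeredBit q y * centeredBit q z := by
  obtain ⟨hq0, hq1⟩ := hq
  obtain ⟨ha0, ha1⟩ := ha
  have hq1' : 0 < 1 - q := by linarith
  have hs : 0 < q * (1 - q) := by positivity
  have hne : q ≠ 0 := hq0.ne'
  have hne' : 1 - q ≠ 0 := hq1'.ne'
  -- For unequal bits the factor is exactly `1 - a`; for equal bits it exceeds 1.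
  have hmix : a / (q * (1 - q)) * (1 - q) * q = a := by field_simp
  cases y <;> cases z <;> simp only [centeredBit, cond_true, cond_false]
  · have : 0 < a / (q * (1 - q)) * q * q := by positivity
    linarith
  · linarith
  · linarith
  · positivity

/-- The Ising model with mean parameters `q` and `α` on a rooted tree has mass function
`interactionMass`. -/
lemma IsMeanParamIsing.measureReal_eq {Ω V : Type*} [MeasurableSpace Ω] [Fintype V]
    [DecidableEq V] {T : SimpleGraph V} (hT : T.IsTree) {q : ℝ} (hq : q ∈ Set.Ioo (0 : ℝ) 1)
    {α : Sym2 V → ℝ} (hα : ∀ e ∈ T.edgeSet, α e ∈ Set.Ioo (0 : ℝ) 1)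
    {P : Measure Ω} [IsProbabilityMeasure P] {J : Ω → V → ℕ}
    (hJ : IsMeanParamIsing T (fun _ => q) α P J) {r : V} {pa : V → V}
    (hpa : ∀ v, v ≠ r → IsParent T r (pa v) v) (x : V → Bool) :
    P.real (J ⁻¹' {bitVector x}) =
      interactionMass q (fun v => α s(pa v, v) / (q * (1 - q))) pa (Finset.univ.erase r) x := by
  have hint := integral_comp_of_binary hJ.ising.measurable hJ.ising.binary
  have hq1 : 0 < 1 - q := by linarith [hq.2]
  have hs : 0 < q * (1 - q) := mul_pos hq.1 hq1
  have hc : ∀ (x : V → Bool) v, (bitVector x v : ℝ) - q = centeredBit q (x v) := by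
    intro x v
    cases h : x v <;> simp [bitVector, centeredBit, h]
  have h0 : ∑ x : V → Bool, P.real (J ⁻¹' {bitVector x}) = 1 := by
    have := hint fun _ => 1
    simpa using this.symm
  have h1 : ∀ v, ∑ x : V → Bool, P.real (J ⁻¹' {bitVector x}) * centeredBit q (x v) = 0 := by
    intro v
    have := hint fun n => (n v : ℝ)
    rw [hJ.mean] at this
    simp only [← hc, mul_sub, Finset.sum_sub_distrib, ← this, ← Finset.sum_mul, h0]
    ring
  have hcov : ∀ u v, covariance (fun ω => (J ω u : ℝ)) (fun ω => (J ω v : ℝ)) P =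
      ∑ x : V → Bool, P.real (J ⁻¹' {bitVector x}) *
        (centeredBit q (x u) * centeredBit q (x v)) := by
    intro u v
    rw [covariance]
    simp only [hJ.mean]
    rw [hint fun n => ((n u : ℝ) - q) * ((n v : ℝ) - q)]
    simp only [hc]
  have hvar : ∀ v, variance (fun ω => (J ω v : ℝ)) P = q * (1 - q) := by
    intro v
    have hmeas : Measurable fun ω => (J ω v : ℝ) :=
      measurable_from_top.comp ((measurable_pi_apply v).comp hJ.ising.measurable)
    rw [← covariance_self hmeas.aemeasurable, hcov]
    simp only [centeredBit_sq, mul_add, Finset.sum_add_distrib, mul_left_comm _ (1 - 2 * q),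
      ← Finset.mul_sum, ← Finset.sum_mul, h0, h1]
    ring
  have h2 : ∀ v ∈ Finset.univ.erase r, ∑ x : V → Bool, P.real (J ⁻¹' {bitVector x}) *
      (centeredBit q (x (pa v)) * centeredBit q (x v)) =
      α s(pa v, v) / (q * (1 - q)) * (q * (1 - q)) ^ 2 := by
    intro v hv
    -- Both variances equal `q(1-q)`, so the covariance along an edge is `α q(1-q)`; this dictates
    -- the choice of `β`.
    have hcorr := hJ.corr _ _ (hpa v (Finset.ne_of_mem_erase hv)).1
    rw [pearsonCorr, hvar, hvar, Real.sqrt_mul_self hs.le, hcov, div_eq_iff hs.ne'] at hcorr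
    rw [hcorr]
    field_simp
  obtain ⟨η₁, η₂, A, -, hpmf⟩ := hJ.ising.pmf
  refine congrFun (eq_interactionMass hq (h := T.dist r)
    (fun v hv => by rw [(hpa v (Finset.ne_of_mem_erase hv)).2]; exact Nat.lt_succ_self _)
    (fun v hv => one_add_mul_centeredBit_pos hq
      (hα _ (hpa v (Finset.ne_of_mem_erase hv)).1))
    (p := fun x : V → Bool => P.real (J ⁻¹' {bitVector x})) (-A)
    (fun v b => η₁ v * (b.toNat : ℝ))
    (fun v y z => η₂ s(pa v, v) * ((y.toNat * z.toNat : ℕ) : ℝ)) (fun x => ?_) h0 h1 h2) x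
  rw [hpmf (bitVector x) fun v => by cases h : x v <;> simp [bitVector, h],
    sum_edgeFinset_eq_sum_parent hT hpa]
  congr 1
  simp only [Sym2.map_mk, Sym2.mul_mk, bitVector]
  ring

/-! ### Lower bound for the law of `N` on bit vectors. -/

lemma measureReal_preimage_of_hasLaw {Ω : Type*} [MeasurableSpace Ω] {P : Measure Ω} {X : Ω → ℕ}
    {μ : Measure ℕ} (hX : HasLaw X μ P) (s : Set ℕ) : P.real (X ⁻¹' s) = μ.real s := by
  rw [← hX.map_eq, measureReal_def, measureReal_def,
    Measure.map_apply_of_aemeasurable hX.aemeasurable .of_discrete]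

lemma sum_measureReal_le {Ω ι : Type*} [MeasurableSpace Ω] {P : Measure Ω} [IsFiniteMeasure P]
    {E : ι → Set Ω} {A : Set Ω} (s : Finset ι) (hdisj : Pairwise (Function.onFun Disjoint E))
    (hE : ∀ i, NullMeasurableSet (E i) P) (hsub : ∀ i ∈ s, E i ⊆ A) :
    ∑ i ∈ s, P.real (E i) ≤ P.real A := by
  simp only [measureReal_def]
  rw [← ENNReal.toReal_sum fun i _ => measure_ne_top P _, ← measure_biUnion_finset₀
    (fun i _ j _ hij => (hdisj hij).aedisjoint) fun i _ => hE i]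
  exact ENNReal.toReal_mono (measure_ne_top P _) (measure_mono (Set.iUnion₂_subset hsub))

/-- The transition probability `Pr(α ∘ y + L = z)`, `L ∼ Poisson(lam)`, between bits `y` and `z`. -/
noncomputable def thinningMass (lam a : ℝ) (y z : Bool) : ℝ :=
  cond z (cond y (a + (1 - a) * lam) lam * Real.exp (-lam)) (cond y (1 - a) 1 * Real.exp (-lam))

lemma poissonMeasure_real_toNat {lam : ℝ} (h : 0 ≤ lam) (z : Bool) :
    (poissonMeasure lam.toNNReal).real {z.toNat} = cond z lam 1 * Real.exp (-lam) := by
  rw [poissonMeasure_real_singleton, Real.coe_toNNReal _ h]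
  cases z <;> simp
  ring

lemma bernoulliLaw_real_toNat {a : ℝ} (ha : a ∈ Set.Ioo (0 : ℝ) 1) (t : Bool) :
    (bernoulliLaw a).real {t.toNat} = bernoulliMass a t := by
  have h1 : 0 ≤ a := ha.1.le
  have h2 : 0 ≤ 1 - a := by linarith [ha.2]
  rw [measureReal_def, bernoulliLaw]
  cases t <;> simp [bernoulliMass, ENNReal.toReal_ofReal, h1, ha.2.le]

/-- In the stochastic representation, the probability of a binary vector is at least the product of
the transition probabilities along the tree. -/
lemma IsMPMRFRepresentation.prod_le_measureReal {Ω V : Type*} [MeasurableSpace Ω] [Fintype V]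
    [DecidableEq V] {T : SimpleGraph V} {q : ℝ} (hq : q ∈ Set.Ioo (0 : ℝ) 1)
    {α : Sym2 V → ℝ} (hα : ∀ e ∈ T.edgeSet, α e ∈ Set.Ioo (0 : ℝ) 1)
    {P : Measure Ω} [IsProbabilityMeasure P] {r : V} {L : V → Ω → ℕ} {I : V → ℕ → Ω → ℕ}
    {N : Ω → V → ℕ} (hN : IsMPMRFRepresentation q α T r P L I N) {pa : V → V}
    (hpa : ∀ v, v ≠ r → IsParent T r (pa v) v) (x : V → Bool) :
    ∏ v, (if v = r then cond (x r) q 1 * Real.exp (-q) else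
      thinningMass (q * (1 - α s(pa v, v))) (α s(pa v, v)) (x (pa v)) (x v)) ≤
      P.real (N ⁻¹' {bitVector x}) := by
  -- The bit `t v` prescribes the trial `I v 0`, and `SL v (t v)` contains the innovations that then
  -- produce `x v`. The root has no trial, so `t r` is pinned to `false` to keep the events `E t`
  -- disjoint.
  set SL : V → Bool → Set ℕ := fun v t =>
    if v = r then {l | t = false ∧ l = (x r).toNat}
      else {l | (x (pa v) && t).toNat + l = (x v).toNat} with hSL
  set SI : V → Bool → Set ℕ := fun v t => if v = r then Set.univ else {t.toNat} with hSI
  set K : V ⊕ V → Ω → ℕ := Sum.elim L fun v => I v 0 with hK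
  have hKindep : iIndepFun K P := by
    have := hN.indep.precomp (g := Sum.map id fun v : V => (v, 0))
      (Function.Injective.sumMap Function.injective_id fun a b h => (Prod.ext_iff.1 h).1)
    convert this using 2 with i
    rcases i with i | i <;> rfl
  set E : (V → Bool) → Set Ω := fun t =>
    ⋂ i : V ⊕ V, K i ⁻¹' Sum.elim (fun v => SL v (t v)) (fun v => SI v (t v)) i with hE
  have hLmeas : ∀ v, AEMeasurable (L v) P := by
    intro v
    rcases eq_or_ne v r with rfl | hv
    · exact hN.law_root.aemeasurable
    · exact (hN.law_innovation _ _ (hpa v hv)).aemeasurable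
  have hEmeas : ∀ t, NullMeasurableSet (E t) P := by
    intro t
    refine NullMeasurableSet.iInter fun i => ?_
    rcases i with v | v
    · exact (hLmeas v).nullMeasurableSet_preimage (MeasurableSet.of_discrete)
    · rcases eq_or_ne v r with rfl | hv
      · simp [hSI]
      · exact (hN.law_trial _ _ (hpa v hv) 0).aemeasurable.nullMeasurableSet_preimage
          (MeasurableSet.of_discrete)
  have hEprob : ∀ t, P.real (E t) =
      ∏ v, (P.real (L v ⁻¹' SL v (t v)) * P.real (I v 0 ⁻¹' SI v (t v))) := by
    intro t
    have := hKindep.measure_inter_preimage_eq_mul (S := Finset.univ)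
      (sets := Sum.elim (fun v => SL v (t v)) (fun v => SI v (t v)))
      (fun i _ => MeasurableSet.of_discrete)
    simp only [Finset.mem_univ, Set.iInter_true] at this
    rw [measureReal_def, hE]
    simp only
    rw [this, ENNReal.toReal_prod, Fintype.prod_sum_type, ← Finset.prod_mul_distrib]
    rfl
  have hdisj : Pairwise (Function.onFun Disjoint E) := by
    intro s t hst
    obtain ⟨v, hv⟩ := Function.ne_iff.1 hst
    refine Set.disjoint_left.2 fun ω hs ht => hv ?_
    simp only [hE, Set.mem_iInter] at hs ht
    rcases eq_or_ne v r with rfl | hvr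
    · have h1 := hs (Sum.inl v)
      have h2 := ht (Sum.inl v)
      simp only [hSL, Sum.elim_inl, if_true, Set.mem_preimage, Set.mem_ofPred_eq] at h1 h2
      rw [h1.1, h2.1]
    · have h1 := hs (Sum.inr v)
      have h2 := ht (Sum.inr v)
      simp only [hSI, Sum.elim_inr, if_neg hvr, Set.mem_preimage, Set.mem_singleton_iff] at h1 h2
      have h3 := h1.symm.trans h2
      cases hs : s v <;> cases ht : t v <;> simp [hs, ht] at h3 ⊢
  have hsub : ∀ t, E t ⊆ N ⁻¹' {bitVector x} := by
    intro t ω hω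
    simp only [hE, Set.mem_iInter] at hω
    have main : ∀ n v, T.dist r v = n → N ω v = bitVector x v := by
      intro n
      induction n with
      | zero =>
        intro v hv
        have hvr : v = r := by
          by_contra hvr
          have := (hpa v hvr).2
          omega
        subst hvr
        have h1 := hω (Sum.inl v)
        simp only [hSL, hK, Sum.elim_inl, if_true, Set.mem_preimage, Set.mem_ofPred_eq] at h1
        rw [hN.eq_root, h1.2]
        rfl
      | succ n ih =>
        intro v hv
        have hvr : v ≠ r := by
          rintro rfl
          simp at hv
        have h1 := hω (Sum.inl v)
        have h2 := hω (Sum.inr v)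
        simp only [hSL, hSI, hK, Sum.elim_inl, Sum.elim_inr, if_neg hvr, Set.mem_preimage,
          Set.mem_ofPred_eq, Set.mem_singleton_iff] at h1 h2
        have hp := (hpa v hvr).2
        rw [hN.eq_child _ _ (hpa v hvr), ih (pa v) (by omega)]
        change _ = (x v).toNat
        rw [← h1]
        cases h : x (pa v) <;> simp [bitVector, h, h2]
    funext v
    exact main _ v rfl
  have hsum : ∑ t, P.real (E t) ≤ P.real (N ⁻¹' {bitVector x}) :=
     sum_measureReal_le _ hdisj hEmeas fun t _ => hsub t
  refine le_trans (le_of_eq ?_) hsum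
  simp only [hEprob]
  -- Summing the product probabilities over all trial outcomes `t` factorises into one transition
  -- probability per vertex.
  have hprod := Finset.prod_univ_sum (fun _ : V => (Finset.univ : Finset Bool))
    (fun v b => P.real (L v ⁻¹' SL v b) * P.real (I v 0 ⁻¹' SI v b))
  rw [Fintype.piFinset_univ] at hprod
  rw [← hprod]
  refine Finset.prod_congr rfl fun v _ => ?_
  rw [Fintype.sum_bool]
  rcases eq_or_ne v r with rfl | hvr
  · have e : SL v false = {(x v).toNat} := by
      ext l
      simp [hSL]
    have e' : SL v true = ∅ := by
      simp [hSL]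
    rw [e', e, measureReal_preimage_of_hasLaw hN.law_root {(x v).toNat},
      poissonMeasure_real_toNat hq.1.le]
    simp [hSI]
  · have ha := hα s(pa v, v) (hpa v hvr).1
    have hlam : 0 ≤ q * (1 - α s(pa v, v)) := mul_nonneg hq.1.le (by linarith [ha.2])
    have hIv : ∀ t, P.real (I v 0 ⁻¹' SI v t) = bernoulliMass (α s(pa v, v)) t := by
      intro t
      rw [measureReal_preimage_of_hasLaw (hN.law_trial _ _ (hpa v hvr) 0),
        ← bernoulliLaw_real_toNat ha]
      simp only [hSI, if_neg hvr]
    have hLv : ∀ t, P.real (L v ⁻¹' SL v t) =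
        (poissonMeasure (q * (1 - α s(pa v, v))).toNNReal).real (SL v t) := fun t =>
      measureReal_preimage_of_hasLaw (hN.law_innovation _ _ (hpa v hvr)) _
    have hP0 := poissonMeasure_real_toNat hlam false
    have hP1 := poissonMeasure_real_toNat hlam true
    have hs : ∀ t, SL v t = if x (pa v) && t then (if x v then {false.toNat} else ∅)
        else {(x v).toNat} := by
      intro t
      simp only [hSL, if_neg hvr]
      ext l
      cases x (pa v) <;> cases t <;> cases x v <;> simp
    rw [if_neg hvr, hIv, hIv, hLv, hLv, hs, hs]
    cases x (pa v) <;> cases x v <;>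
      simp only [Bool.and_true, Bool.and_false, if_true, if_false, hP0, hP1, thinningMass,
        bernoulliMass, cond_true, cond_false, measureReal_empty, Bool.false_eq_true] <;> ring

/-! ### Discrepancies at the root and along the edges. -/

/-- Clears the division: `w` is a pair mass, `c` the parent's mass and `a` the conditional mass of
the child, so only `c * a - c * b` has to be bounded. -/
lemma mul_max_zero_one_sub_div_le {w c a b B : ℝ} (hw : w = c * a) (ha : 0 < a) (hc : 0 ≤ c)
    (hB : 0 ≤ B) (h : c * a - c * b ≤ B) : w * max 0 (1 - b / a) ≤ B := by
  rw [hw, mul_max_of_nonneg _ _ (mul_nonneg hc ha.le)]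
  refine max_le (by simpa using hB) ?_
  have : c * a * (1 - b / a) = c * a - c * b := by
    field_simp
  rw [this]
  exact h

/-- The root contributes at most `q²` to the total variation distance. -/
lemma root_discrepancy_le {q : ℝ} (hq : q ∈ Set.Ioo (0 : ℝ) 1) :
    q * max 0 (1 - q * Real.exp (-q) / q) + (1 - q) * max 0 (1 - 1 * Real.exp (-q) / (1 - q)) ≤
      q ^ 2 := by
  have hexp := Real.one_sub_le_exp_neg q
  have h1 : q * max 0 (1 - q * Real.exp (-q) / q) ≤ q ^ 2 :=
    mul_max_zero_one_sub_div_le (c := 1) (one_mul q).symm hq.1 zero_le_one (sq_nonneg q)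
      (by nlinarith [mul_le_mul_of_nonneg_left hexp hq.1.le])
  have h2 : (1 - q) * max 0 (1 - 1 * Real.exp (-q) / (1 - q)) ≤ 0 :=
    mul_max_zero_one_sub_div_le (c := 1) (one_mul _).symm (by linarith [hq.2]) zero_le_one le_rfl
      (by linarith)
  linarith

/-- Each edge contributes at most `q²` to the total variation distance. -/
lemma edge_discrepancy_le {q a : ℝ} (hq : q ∈ Set.Ioo (0 : ℝ) 1) (ha : a ∈ Set.Ioo (0 : ℝ) 1)
    {D : Bool → Bool → ℝ} (hD : ∀ y z, D y z = max 0 (1 - thinningMass (q * (1 - a)) a y z /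
      (bernoulliMass q z * (1 + a / (q * (1 - q)) * centeredBit q y * centeredBit q z)))) :
    (q ^ 2 + a * (q * (1 - q))) * D true true + (q * (1 - q) - a * (q * (1 - q))) * D true false +
      (q * (1 - q) - a * (q * (1 - q))) * D false true +
      ((1 - q) ^ 2 + a * (q * (1 - q))) * D false false ≤ q ^ 2 := by
  have hpos : ∀ y z, 0 < bernoulliMass q z *
      (1 + a / (q * (1 - q)) * centeredBit q y * centeredBit q z) := fun y z =>
    mul_pos (bernoulliMass_pos hq z) (one_add_mul_centeredBit_pos hq ha y z)
  obtain ⟨hq0, hq1⟩ := hq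
  obtain ⟨ha0, ha1⟩ := ha
  have hq1' : 0 < 1 - q := by linarith
  have ha1' : 0 < 1 - a := by linarith
  have hne : q ≠ 0 := hq0.ne'
  have hne' : 1 - q ≠ 0 := hq1'.ne'
  have hlam : 0 < q * (1 - a) := by positivity
  have hexp := Real.one_sub_le_exp_neg (q * (1 - a))
  -- These four products are the Ising transition probabilities from parent bit to child bit.
  have e11 : bernoulliMass q true *
      (1 + a / (q * (1 - q)) * centeredBit q true * centeredBit q true) = q + a * (1 - q) := by
    simp only [bernoulliMass, centeredBit, cond_true]
    field_simp
  have e10 : bernoulliMass q false *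
      (1 + a / (q * (1 - q)) * centeredBit q true * centeredBit q false) =
        (1 - q) * (1 - a) := by
    simp only [bernoulliMass, centeredBit, cond_true, cond_false]
    field_simp
    ring
  have e01 : bernoulliMass q true *
      (1 + a / (q * (1 - q)) * centeredBit q false * centeredBit q true) = q * (1 - a) := by
    simp only [bernoulliMass, centeredBit, cond_true, cond_false]
    field_simp
    ring
  have e00 : bernoulliMass q false *
      (1 + a / (q * (1 - q)) * centeredBit q false * centeredBit q false) =
        1 - q * (1 - a) := by
    simp only [bernoulliMass, centeredBit, cond_false]
    field_simp
    ring
  have p11 := hpos true true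
  have p10 := hpos true false
  have p01 := hpos false true
  have p00 := hpos false false
  rw [e11] at p11
  rw [e10] at p10
  rw [e01] at p01
  rw [e00] at p00
  rw [hD, hD, hD, hD, e11, e10, e01, e00]
  simp only [thinningMass, cond_true, cond_false]
  set lam := q * (1 - a) with hlamdef
  set E := Real.exp (-lam)
  have b11 : (q ^ 2 + a * (q * (1 - q))) *
      max 0 (1 - (a + (1 - a) * lam) * E / (q + a * (1 - q))) ≤
        q * (2 * a * lam + (1 - a) * lam ^ 2) := by
    refine mul_max_zero_one_sub_div_le (c := q) (by ring) p11 hq0.le (by positivity) ?_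
    rw [← mul_sub]
    refine mul_le_mul_of_nonneg_left ?_ hq0.le
    have := mul_le_mul_of_nonneg_left hexp (by positivity : 0 ≤ a + (1 - a) * lam)
    have hs : q + a * (1 - q) = a + lam := by rw [hlamdef]; ring
    rw [hs]
    nlinarith
  -- A child equal to 0 creates no deficit: here `1 - q ≤ 1 - lam ≤ E`.
  have b10 : (q * (1 - q) - a * (q * (1 - q))) *
      max 0 (1 - (1 - a) * E / ((1 - q) * (1 - a))) ≤ 0 := by
    refine mul_max_zero_one_sub_div_le (c := q) (by ring) p10 hq0.le le_rfl ?_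
    rw [← mul_sub]
    have hle : 1 - q ≤ E := by nlinarith
    have := mul_le_mul_of_nonneg_right hle ha1'.le
    exact mul_nonpos_of_nonneg_of_nonpos hq0.le (by linarith)
  have b01 : (q * (1 - q) - a * (q * (1 - q))) * max 0 (1 - lam * E / lam) ≤
      (1 - q) * lam ^ 2 := by
    refine mul_max_zero_one_sub_div_le (c := 1 - q) (by rw [hlamdef]; ring) hlam hq1'.le
      (by positivity) ?_
    rw [← mul_sub]
    refine mul_le_mul_of_nonneg_left ?_ hq1'.le
    nlinarith [mul_le_mul_of_nonneg_left hexp hlam.le]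
  have b00 : ((1 - q) ^ 2 + a * (q * (1 - q))) * max 0 (1 - 1 * E / (1 - lam)) ≤ 0 := by
    refine mul_max_zero_one_sub_div_le (c := 1 - q) (by rw [hlamdef]; ring) p00 hq1'.le le_rfl ?_
    rw [← mul_sub]
    exact mul_nonpos_of_nonneg_of_nonpos hq1'.le (by linarith)
  -- The two deficits for a child equal to 1 add up to `q ^ 2` minus nonnegative terms, uniformly in
  -- `a`.
  have hfin : q * (2 * a * lam + (1 - a) * lam ^ 2) + (1 - q) * lam ^ 2 =
      q ^ 2 - q ^ 2 * a ^ 2 - q ^ 2 * (q * a * (1 - a) ^ 2) := by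
    rw [hlamdef]
    ring
  have : 0 ≤ q ^ 2 * a ^ 2 := by positivity
  have : 0 ≤ q ^ 2 * (q * a * (1 - a) ^ 2) := by positivity
  linarith

/-! ### Total variation and the main bound. -/

/-- The total variation distance between a binary random vector `J` and `N` is at most `ε` if the
mass function of `N` is bounded below by some `b` on the binary vectors, and the mass function of
`J` exceeds `b` by at most `ε` in total on any set of binary vectors. -/
lemma tvDist_le_of_binary {V Ω Ω' : Type*} [Fintype V] [DecidableEq V] [MeasurableSpace Ω]
    [MeasurableSpace Ω'] {P : Measure Ω} [IsProbabilityMeasure P] {P' : Measure Ω'}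
    [IsProbabilityMeasure P'] {J : Ω → V → ℕ} (hJ : Measurable J)
    (hb : ∀ᵐ ω ∂P, ∀ v, J ω v = 0 ∨ J ω v = 1) {N : Ω' → V → ℕ} (hN : AEMeasurable N P')
    {b : (V → Bool) → ℝ} (hbN : ∀ x, b x ≤ P'.real (N ⁻¹' {bitVector x})) {ε : ℝ}
    (hε : ∀ s : Finset (V → Bool), ∑ x ∈ s, (P.real (J ⁻¹' {bitVector x}) - b x) ≤ ε) :
    tvDist P (fun ω v => (J ω v : ℝ)) P' (fun ω v => (N ω v : ℝ)) ≤ ε := by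
  classical
  have honeside : ∀ B : Set (V → ℕ), P.real (J ⁻¹' B) - P'.real (N ⁻¹' B) ≤ ε := by
    intro B
    have hBm : MeasurableSet B := B.to_countable.measurableSet
    have h1 : P.real (J ⁻¹' B) =
        ∑ x with bitVector x ∈ B, P.real (J ⁻¹' {bitVector x}) := by
      have := integral_comp_of_binary hJ hb (B.indicator 1)
      rw [Finset.sum_filter, ← integral_indicator_one (hJ hBm)]
      simpa [Set.indicator_apply] using this
    have h2 : ∑ x with bitVector x ∈ B, P'.real (N ⁻¹' {bitVector x}) ≤ P'.real (N ⁻¹' B) := by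
      refine sum_measureReal_le _ (fun x y hxy => ?_)
        (fun x => hN.nullMeasurableSet_preimage (measurableSet_singleton _)) fun x hx => ?_
      · exact Disjoint.preimage _ (by simpa using fun h => hxy (bitVector_injective h))
      · exact Set.preimage_mono (by simpa using hx)
    have h3 := hε (Finset.univ.filter fun x => bitVector x ∈ B)
    have h4 := Finset.sum_le_sum
      fun x (_ : x ∈ Finset.univ.filter fun x : V → Bool => bitVector x ∈ B) => hbN x
    rw [Finset.sum_sub_distrib] at h3
    linarith
  refine ciSup_le fun A => ?_
  set B : Set (V → ℕ) := (fun n v => (n v : ℝ)) ⁻¹' A.1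
  have hBm : MeasurableSet B := B.to_countable.measurableSet
  change |P.real (J ⁻¹' B) - P'.real (N ⁻¹' B)| ≤ ε
  have h1 := honeside B
  -- Passing to the complement reverses the sign of the difference, which gives the other side of
  -- the absolute value.
  have h2 := honeside Bᶜ
  have e1 : P.real (J ⁻¹' Bᶜ) = 1 - P.real (J ⁻¹' B) := probReal_compl_eq_one_sub (hJ hBm)
  have e2 : P'.real (N ⁻¹' Bᶜ) = 1 - P'.real (N ⁻¹' B) :=
    probReal_compl_eq_one_sub₀ (hN.nullMeasurableSet_preimage hBm)
  rw [abs_le]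
  constructor <;> linarith

theorem theorem4 {V Ω Ω' : Type*} [Fintype V] [MeasurableSpace Ω] [MeasurableSpace Ω']
    (T : SimpleGraph V) (hT : T.IsTree)
    (q : ℝ) (hq : q ∈ Set.Ioo (0 : ℝ) 1)
    (α : Sym2 V → ℝ) (hα : ∀ e ∈ T.edgeSet, α e ∈ Set.Ioo (0 : ℝ) 1)
    (P : Measure Ω) [IsProbabilityMeasure P] (P' : Measure Ω') [IsProbabilityMeasure P']
    (J : Ω → V → ℕ) (hJ : IsMeanParamIsing T (fun _ => q) α P J)
    (N : Ω' → V → ℕ) (hN : IsMPMRF q α T P' N) :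
    tvDist P (fun ω v => (J ω v : ℝ)) P' (fun ω v => (N ω v : ℝ))
      ≤ 1.2 * (Fintype.card V : ℝ) * q ^ 2 := by
  classical
  obtain ⟨r, Ω₀, _, P₀, _, L, I, N₀, hrep, hid⟩ := hN
  -- The parent chosen for the root itself is arbitrary; the root is treated separately below.
  have hex : ∀ v, ∃ u, v ≠ r → IsParent T r u v := by
    intro v
    by_cases hv : v = r
    · exact ⟨r, fun h => absurd hv h⟩
    · obtain ⟨u, hu⟩ := exists_isParent hT.connected hv
      exact ⟨u, fun _ => hu⟩
  choose pa hpa using hex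
  set β : V → ℝ := fun v => α s(pa v, v) / (q * (1 - q)) with hβ
  have hq1 : 0 < 1 - q := by linarith [hq.2]
  have hαv : ∀ v, v ≠ r → α s(pa v, v) ∈ Set.Ioo (0 : ℝ) 1 := fun v hv => hα _ (hpa v hv).1
  set W := interactionMass q β pa (Finset.univ.erase r) with hW
  have hJW : ∀ x, P.real (J ⁻¹' {bitVector x}) = W x := hJ.measureReal_eq hT hq hα hpa
  set a : V → (V → Bool) → ℝ := fun v x => if v = r then bernoulliMass q (x r) else
    bernoulliMass q (x v) * (1 + β v * centeredBit q (x (pa v)) * centeredBit q (x v)) with ha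
  set b : V → (V → Bool) → ℝ := fun v x => if v = r then cond (x r) q 1 * Real.exp (-q) else
    thinningMass (q * (1 - α s(pa v, v))) (α s(pa v, v)) (x (pa v)) (x v) with hb
  have hWa : ∀ x, W x = ∏ v, a v x := by
    intro x
    rw [hW, interactionMass, ← Finset.mul_prod_erase _ (fun v => a v x) (Finset.mem_univ r),
      ← Finset.mul_prod_erase _ (fun v => bernoulliMass q (x v)) (Finset.mem_univ r), mul_assoc,
      ← Finset.prod_mul_distrib]
    congr 1
    · simp [ha]
    · refine Finset.prod_congr rfl fun v hv => ?_
      simp only [ha, if_neg (Finset.ne_of_mem_erase hv)]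
  have hapos : ∀ v x, 0 < a v x := by
    intro v x
    simp only [ha]
    split_ifs with hv
    · exact bernoulliMass_pos hq _
    · exact mul_pos (bernoulliMass_pos hq _) (one_add_mul_centeredBit_pos hq (hαv v hv) _ _)
  have hbnn : ∀ v x, 0 ≤ b v x := by
    intro v x
    simp only [hb]
    have := hq.1
    split_ifs with hv
    · cases x r <;> simp <;> positivity
    · have h0 := (hαv v hv).1
      have h1 : 0 < 1 - α s(pa v, v) := by linarith [(hαv v hv).2]
      cases x (pa v) <;> cases x v <;> simp only [thinningMass, cond_true, cond_false] <;>
        positivity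
  have hbN : ∀ x, ∏ v, b v x ≤ P'.real (N ⁻¹' {bitVector x}) := by
    intro x
    refine (hrep.prod_le_measureReal hq hα hpa x).trans_eq ?_
    simp only [measureReal_def]
    rw [hid.measure_mem_eq (measurableSet_singleton _)]
  obtain ⟨w0, w1, w2⟩ := interactionMass_moments q β pa (T.dist r) (Finset.univ.erase r)
    fun v hv => by rw [(hpa v (Finset.ne_of_mem_erase hv)).2]; exact Nat.lt_succ_self _
  have hvertex : ∀ v, ∑ x, W x * max 0 (1 - b v x / a v x) ≤ q ^ 2 := by
    intro v
    rcases eq_or_ne v r with rfl | hv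
    · have := sum_mul_apply_of_mean w0 (w1 v)
        fun z => max 0 (1 - cond z q 1 * Real.exp (-q) / bernoulliMass q z)
      simp only [ha, hb, if_true]
      rw [hW, this]
      exact root_discrepancy_le hq
    · have := sum_mul_pair_of_moments w0 (w1 (pa v)) (w1 v) (w2 v (by simpa using hv))
        fun y z => max 0 (1 - thinningMass (q * (1 - α s(pa v, v))) (α s(pa v, v)) y z /
          (bernoulliMass q z * (1 + β v * centeredBit q y * centeredBit q z)))
      simp only [ha, hb, if_neg hv]
      rw [hW, this]
      have hκ : β v * (q * (1 - q)) ^ 2 = α s(pa v, v) * (q * (1 - q)) := by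
        have := hq.1.ne'
        have := hq1.ne'
        simp only [hβ]
        field_simp
      rw [hκ]
      exact edge_discrepancy_le hq (hαv v hv) (D := fun y z => max 0 (1 -
        thinningMass (q * (1 - α s(pa v, v))) (α s(pa v, v)) y z /
          (bernoulliMass q z * (1 + β v * centeredBit q y * centeredBit q z)))) fun y z => rfl
  have hmain : tvDist P (fun ω v => (J ω v : ℝ)) P' (fun ω v => (N ω v : ℝ)) ≤
      Fintype.card V * q ^ 2 := by
    refine tvDist_le_of_binary hJ.ising.measurable hJ.ising.binary hid.aemeasurable_fst hbN
      fun s => ?_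
    have hWnn : ∀ x, 0 ≤ W x := fun x => by
      rw [hWa]
      exact Finset.prod_nonneg fun v _ => (hapos v x).le
    calc ∑ x ∈ s, (P.real (J ⁻¹' {bitVector x}) - ∏ v, b v x)
        ≤ ∑ x ∈ s, W x * ∑ v, max 0 (1 - b v x / a v x) := by
          refine Finset.sum_le_sum fun x _ => ?_
          rw [hJW, hWa]
          exact prod_sub_prod_le _ _ _ (fun v _ => hapos v x) fun v _ => hbnn v x
      _ ≤ ∑ x, W x * ∑ v, max 0 (1 - b v x / a v x) :=
          Finset.sum_le_sum_of_subset_of_nonneg (Finset.subset_univ s) fun x _ _ =>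
            mul_nonneg (hWnn x) (Finset.sum_nonneg fun v _ => le_max_left _ _)
      _ = ∑ v, ∑ x, W x * max 0 (1 - b v x / a v x) := by
          simp only [Finset.mul_sum]
          exact Finset.sum_comm
      _ ≤ ∑ _v : V, q ^ 2 := Finset.sum_le_sum fun v _ => hvertex v
      _ = Fintype.card V * q ^ 2 := by simp
  -- The bound already holds with constant 1; nonnegativity lets it be relaxed to 1.2.
  have hnn : 0 ≤ (Fintype.card V : ℝ) * q ^ 2 := by positivity
  rw [mul_assoc]
  linarith
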